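/- Let $K,L,A,B$ be non-empty finite sets, $M:K\times L\times A\times B\to\mathbb R$, $T\ge 1$, $p\in\Delta(K)$ and $q\in\Delta(L)$ (probability distributions). In the $T$-stage repeated Bayesian game $\Gamma_T(p,q)$, types $k$ and $l$ are drawn independently from $p$ and $q$; player 1 is told $k$, player 2 is told $l$. At each stage $t=1,\dots,T$ the players simultaneously choose $a_t\in A$ and $b_t\in B$, which are then announced publicly. Put $H^A_t=A^{t-1}$, $H^B_t=B^{t-1}$. A behavior strategy of player 1 is $\sigma=(\sigma_t)_{t=1}^T$ with $\sigma_t:K\times H^A_t\times H^B_t\to\Delta(A)$; one of player 2 is $\tau=(\tau_t)_{t=1}^T$ with $\tau_t:L\times H^A_t\times H^B_t\to\Delta(B)$. The payoff is $\gamma_T(\sigma,\tau)=\mathbb E_{p,q,\sigma,\tau}\big[\sum_{t=1}^T M(k,l,a_t,b_t)\big]$, which player 1 maximizes and player 2 minimizes. The security levels are $\max_\sigma\min_\tau\gamma_T$ and $\min_\tau\max_\sigma\gamma_T$; a security strategy of player 1 is a $\sigma$ with $\min_\tau\gamma_T(\sigma,\tau)=\max_{\sigma'}\min_\tau\gamma_T(\sigma',\tau)$,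 and one of player 2 is a $\tau$ with $\max_\sigma\gamma_T(\sigma,\tau)=\min_{\tau'}\max_\sigma\gamma_T(\sigma,\tau')$. The game has a value $V_T(p,q)$, the common value of the two security levels, all the maxima and minima being attained. Write $h_{t+1}=(h_t,a_t,b_t)$ for the pair of histories $h_t=(h^A_t,h^B_t)\in H^A_t\times H^B_t$ followed by the actions $a_t,b_t$. **Player 1.** Let $X$ be the set of real vectors $x=(x^{a}_{k,h_t})$, indexed by $1\le t\le T$, $k\in K$, $h_t\in H^A_t\times H^B_t$, $a\in A$, with $x\ge 0$ and $\sum_{a\in A}x^{a}_{k,h_t}=x^{a_{t-1}}_{k,h_{t-1}}$ for all $t=1,\dots,T$, where for $t=1$ the right side means $p^k$. Then $$V_T(p,q)=\max_{x,u,u_0}\ \sum_{l\in L}q^l u_{l,0},$$ the maximum being attained, over $x\in X$, $u_{l,0}\in\mathbb R$ ($l\in L$) and real numbers $u^{a,b}_{l,h_t}$ ($1\le t\le T-1$, $l\in L$, $h_t\in H^A_t\times H^B_t$, $a\in A$, $b\in B$), with $u^{a,b}_{l,h_T}:=0$, subject to, for all $l\in L$ and $b\in B$, $$\sum_{k\in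 K}\sum_{a\in A}M(k,l,a,b)\,x^a_{k,h_1}+\sum_{a\in A}u^{a,b}_{l,h_1}\ \ge\ u_{l,0},$$ $$\sum_{k\in K}\sum_{a\in A}M(k,l,a,b)\,x^a_{k,h_{t+1}}+\sum_{a\in A}u^{a,b}_{l,h_{t+1}}\ \ge\ u^{a_t,b_t}_{l,h_t}\qquad(1\le t\le T-1,\ h_{t+1}=(h_t,a_t,b_t)).$$ For every optimal solution $(x^*,u^*,u_0^*)$ there is a behavior strategy $\sigma^*$ with $$\sigma^{*a_t}_t(k,h^A_t,h^B_t)=\frac{x^{*a_t}_{k,h_t}}{x^{*a_{t-1}}_{k,h_{t-1}}}\quad\text{whenever the denominator is nonzero}\qquad(\text{the denominator being }p^k\text{ for }t=1),$$ and a behavior strategy of player 1 is a security strategy if and only if it is related in this way to some optimal solution (in particular every $\sigma^*$ so obtained is a security strategy, whatever distributions are used where the denominator vanishes). **Player 2.** Let $Y$ be the set of real vectors $y=(y^{b}_{l,h_t})\ge 0$, indexed by $1\le t\le T$, $l\in L$, $h_t\in H^A_t\times H^B_t$, $b\in B$, with $\sum_{b\in B}y^{b}_{l,h_t}=y^{b_{t-1}}_{l,h_{t-1}}$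 for all $t=1,\dots,T$, where for $t=1$ the right side means $q^l$. Then $$V_T(p,q)=\min_{y,w,w_0}\ \sum_{k\in K}p^k w_{k,0},$$ the minimum being attained, over $y\in Y$, $w_{k,0}\in\mathbb R$ ($k\in K$) and real numbers $w^{a,b}_{k,h_t}$ ($1\le t\le T-1$, $k\in K$, $h_t\in H^A_t\times H^B_t$, $a\in A$, $b\in B$), with $w^{a,b}_{k,h_T}:=0$, subject to, for all $k\in K$ and $a\in A$, $$\sum_{l\in L}\sum_{b\in B}M(k,l,a,b)\,y^b_{l,h_1}+\sum_{b\in B}w^{a,b}_{k,h_1}\ \le\ w_{k,0},$$ $$\sum_{l\in L}\sum_{b\in B}M(k,l,a,b)\,y^b_{l,h_{t+1}}+\sum_{b\in B}w^{a,b}_{k,h_{t+1}}\ \le\ w^{a_t,b_t}_{k,h_t}\qquad(1\le t\le T-1,\ h_{t+1}=(h_t,a_t,b_t)).$$ For every optimal solution $(y^*,w^*,w_0^*)$ there is a behavior strategy $\tau^*$ with $\tau^{*b_t}_t(l,h^A_t,h^B_t)=y^{*b_t}_{l,h_t}/y^{*b_{t-1}}_{l,h_{t-1}}$ whenever the denominator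 (which is $q^l$ for $t=1$) is nonzero, and a behavior strategy of player 2 is a security strategy if and only if it is related in this way to some optimal solution. -/

import Mathlib

open scoped BigOperators

namespace RepeatedBayesianGame

/-! Stages are numbered from `0` to `T - 1`.  At stage `t : Fin T` the histories of the two players
are `hA : Fin t → A` and `hB : Fin t → B`, the actions at the stages before `t`. -/

/-- Behavior strategies of a player with type set `Θ` and action set `C`: at every stage, own type
and histories of both players are mapped to a probability distribution on `C`.
Player 1 has `Θ = K`, `C = A`; player 2 has `Θ = L`, `C = B`. -/
abbrev Strategy (Θ A B C : Type*) [Fintype C] (T : ℕ) : Type _ :=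
  (t : Fin T) → Θ → (Fin t → A) → (Fin t → B) → stdSimplex ℝ C

/-- Real vectors with one entry for each stage, type, pair of histories and own action. -/
abbrev Plan (Θ A B C : Type*) (T : ℕ) : Type _ :=
  (t : Fin T) → Θ → (Fin t → A) → (Fin t → B) → C → ℝ

/-- Real vectors with one `A × B` matrix for each stage, type and pair of histories. -/
abbrev Continuation (Θ A B : Type*) (T : ℕ) : Type _ :=
  (t : Fin T) → Θ → (Fin t → A) → (Fin t → B) → A → B → ℝ

/-- The entry of `g` at the preceding stage along the histories `hA`, `hB`; before the first stage
it is the initial value `c`. -/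
def prevEntry {A B : Type*} {T : ℕ} (c : ℝ)
    (g : (t : Fin T) → (Fin t → A) → (Fin t → B) → A → B → ℝ) :
    (t : Fin T) → (Fin t → A) → (Fin t → B) → ℝ
  | ⟨0, _⟩, _, _ => c
  | ⟨t + 1, h⟩, hA, hB =>
      g ⟨t, Nat.lt_of_succ_lt h⟩ (Fin.init (α := fun _ => A) hA) (Fin.init (α := fun _ => B) hB)
        (hA (Fin.last t)) (hB (Fin.last t))

section Game

variable {K L A B : Type*} [Fintype K] [Fintype L] [Fintype A] [Fintype B] {T : ℕ}

/-- Probability of the play `(k, l, a, b)` under the priors `p`, `q` and the strategies `σ`, `τ`. -/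
def playProb (p : K → ℝ) (q : L → ℝ) (σ : Strategy K A B A T) (τ : Strategy L A B B T)
    (k : K) (l : L) (a : Fin T → A) (b : Fin T → B) : ℝ :=
  p k * q l * ∏ t : Fin T,
    (σ t k (Fin.take t t.isLt.le a) (Fin.take t t.isLt.le b)).1 (a t) *
      (τ t l (Fin.take t t.isLt.le a) (Fin.take t t.isLt.le b)).1 (b t)

/-- The expected total payoff of player 1. -/
def payoff (M : K → L → A → B → ℝ) (p : K → ℝ) (q : L → ℝ)
    (σ : Strategy K A B A T) (τ : Strategy L A B B T) : ℝ :=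
  ∑ k : K, ∑ l : L, ∑ a : Fin T → A, ∑ b : Fin T → B,
    playProb p q σ τ k l a b * ∑ t : Fin T, M k l (a t) (b t)

/-- `v = max_σ min_τ payoff`, all extrema being attained. -/
def IsSecurityLevel₁ (M : K → L → A → B → ℝ) (T : ℕ) (p : K → ℝ) (q : L → ℝ) (v : ℝ) : Prop :=
  IsGreatest {c : ℝ | ∃ σ : Strategy K A B A T,
    IsLeast (Set.range fun τ : Strategy L A B B T => payoff M p q σ τ) c} v

/-- `v = min_τ max_σ payoff`, all extrema being attained. -/
def IsSecurityLevel₂ (M : K → L → A → B → ℝ) (T : ℕ) (p : K → ℝ) (q : L → ℝ) (v : ℝ) : Prop :=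
  IsLeast {c : ℝ | ∃ τ : Strategy L A B B T,
    IsGreatest (Set.range fun σ : Strategy K A B A T => payoff M p q σ τ) c} v

/-- The game has a value and this value is `v`. -/
def IsGameValue (M : K → L → A → B → ℝ) (T : ℕ) (p : K → ℝ) (q : L → ℝ) (v : ℝ) : Prop :=
  IsSecurityLevel₁ M T p q v ∧ IsSecurityLevel₂ M T p q v

/-- `σ` guarantees player 1 his security level. -/
def IsSecurityStrategy₁ (M : K → L → A → B → ℝ) (p : K → ℝ) (q : L → ℝ)
    (σ : Strategy K A B A T) : Prop :=
  ∃ v : ℝ, IsSecurityLevel₁ M T p q v ∧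
    IsLeast (Set.range fun τ : Strategy L A B B T => payoff M p q σ τ) v

/-- `τ` guarantees player 2 his security level. -/
def IsSecurityStrategy₂ (M : K → L → A → B → ℝ) (p : K → ℝ) (q : L → ℝ)
    (τ : Strategy L A B B T) : Prop :=
  ∃ v : ℝ, IsSecurityLevel₂ M T p q v ∧
    IsGreatest (Set.range fun σ : Strategy K A B A T => payoff M p q σ τ) v

/-- The entry of player 1's plan `x` at the preceding stage (`p k` before the first stage). -/
def prevPlan₁ (p : K → ℝ) (x : Plan K A B A T) (t : Fin T) (k : K)
    (hA : Fin t → A) (hB : Fin t → B) : ℝ :=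
  prevEntry (p k) (fun s gA gB a _ => x s k gA gB a) t hA hB

/-- The entry of player 2's plan `y` at the preceding stage (`q l` before the first stage). -/
def prevPlan₂ (q : L → ℝ) (y : Plan L A B B T) (t : Fin T) (l : L)
    (hA : Fin t → A) (hB : Fin t → B) : ℝ :=
  prevEntry (q l) (fun s gA gB _ b => y s l gA gB b) t hA hB

/-- The realization plans of player 1 (the polytope `X`). -/
def IsRealizationPlan₁ (p : K → ℝ) (x : Plan K A B A T) : Prop :=
  (∀ t k hA hB, ∑ a : A, x t k hA hB a = prevPlan₁ p x t k hA hB) ∧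
    ∀ t k hA hB a, 0 ≤ x t k hA hB a

/-- The realization plans of player 2 (the polytope `Y`). -/
def IsRealizationPlan₂ (q : L → ℝ) (y : Plan L A B B T) : Prop :=
  (∀ t l hA hB, ∑ b : B, y t l hA hB b = prevPlan₂ q y t l hA hB) ∧
    ∀ t l hA hB b, 0 ≤ y t l hA hB b

/-- Feasibility in the linear program of player 1, with variables `x`, `u`, `u₀`. -/
structure PrimalFeasible (M : K → L → A → B → ℝ) (p : K → ℝ)
    (x : Plan K A B A T) (u : Continuation L A B T) (u₀ : L → ℝ) : Prop where
  plan : IsRealizationPlan₁ p x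
  terminal : ∀ t : Fin T, (t : ℕ) + 1 = T → ∀ l hA hB a b, u t l hA hB a b = 0
  bound : ∀ (t : Fin T) (l : L) (hA : Fin t → A) (hB : Fin t → B) (b : B),
    prevEntry (u₀ l) (fun s gA gB => u s l gA gB) t hA hB ≤
      (∑ k : K, ∑ a : A, M k l a b * x t k hA hB a) + ∑ a : A, u t l hA hB a b

/-- Feasibility in the linear program of player 2, with variables `y`, `w`, `w₀`. -/
structure DualFeasible (M : K → L → A → B → ℝ) (q : L → ℝ)
    (y : Plan L A B B T) (w : Continuation K A B T) (w₀ : K → ℝ) : Prop where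
  plan : IsRealizationPlan₂ q y
  terminal : ∀ t : Fin T, (t : ℕ) + 1 = T → ∀ k hA hB a b, w t k hA hB a b = 0
  bound : ∀ (t : Fin T) (k : K) (hA : Fin t → A) (hB : Fin t → B) (a : A),
    (∑ l : L, ∑ b : B, M k l a b * y t l hA hB b) + ∑ b : B, w t k hA hB a b ≤
      prevEntry (w₀ k) (fun s gA gB => w s k gA gB) t hA hB

/-- Optimal solutions of the program of player 1, which maximizes `∑ l, q l * u₀ l`. -/
def PrimalOptimal (M : K → L → A → B → ℝ) (p : K → ℝ) (q : L → ℝ)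
    (x : Plan K A B A T) (u : Continuation L A B T) (u₀ : L → ℝ) : Prop :=
  PrimalFeasible M p x u u₀ ∧
    ∀ (x' : Plan K A B A T) (u' : Continuation L A B T) (u₀' : L → ℝ),
      PrimalFeasible M p x' u' u₀' → ∑ l : L, q l * u₀' l ≤ ∑ l : L, q l * u₀ l

/-- Optimal solutions of the program of player 2, which minimizes `∑ k, p k * w₀ k`. -/
def DualOptimal (M : K → L → A → B → ℝ) (p : K → ℝ) (q : L → ℝ)
    (y : Plan L A B B T) (w : Continuation K A B T) (w₀ : K → ℝ) : Prop :=
  DualFeasible M q y w w₀ ∧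
    ∀ (y' : Plan L A B B T) (w' : Continuation K A B T) (w₀' : K → ℝ),
      DualFeasible M q y' w' w₀' → ∑ k : K, p k * w₀ k ≤ ∑ k : K, p k * w₀' k

/-- `σ` is given by the ratios of successive entries of `x` wherever the denominator is nonzero. -/
def IsRatioStrategy₁ (p : K → ℝ) (x : Plan K A B A T) (σ : Strategy K A B A T) : Prop :=
  ∀ t k hA hB, prevPlan₁ p x t k hA hB ≠ 0 →
    ∀ a, (σ t k hA hB).1 a = x t k hA hB a / prevPlan₁ p x t k hA hB

/-- `τ` is given by the ratios of successive entries of `y` wherever the denominator is nonzero. -/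
def IsRatioStrategy₂ (q : L → ℝ) (y : Plan L A B B T) (τ : Strategy L A B B T) : Prop :=
  ∀ t l hA hB, prevPlan₂ q y t l hA hB ≠ 0 →
    ∀ b, (τ t l hA hB).1 b = y t l hA hB b / prevPlan₂ q y t l hA hB

end Game

end RepeatedBayesianGame

/-!
Write `reach p σ n k hA hB` for the realization weight of a history: the prior weight of the type
times the probabilities of the player's own actions along the history. The probability of a play is
the product of the two players' realization weights, and the entries `planOf p σ` of these weights
are exactly the realization plans; conversely a realization plan is `planOf p σ` for every `σ` given
by its ratios (`IsRatioStrategy₁.eq_planOf`), because it vanishes after a vanishing entry.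

Fix `σ`. For any continuation values `v`, the payoff of the first `n` stages plus the sum of `v`
over the histories of stage `n`, weighted with the realization weights of player 2, changes from `n`
to `n + 1` by the equally weighted gap between what the actions of player 2 bring and `v`
(`partialPayoff_add_continuationTotal_succ`). The constraints of the linear program
say that this gap is nonnegative, so the objective of a feasible point bounds the payoff from below
(`PrimalFeasible.sum_le_payoff`). Backward induction produces values for which the gap vanishes
against a best response (`exists_primalFeasible_planOf`). Hence the best objective compatible with
the plan of `σ` is the guarantee `min_τ γ(σ, τ)`, and maximizing over plans gives the security level
together with the description of the security strategies.

The value exists because the payoff is bilinear in the realization plans, which form compact convex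
sets, so that Sion's minimax theorem gives a saddle point (`exists_saddlePoint`). The statements for
player 2 are those for player 1 in the game with the roles exchanged and the payoffs negated.
-/

namespace RepeatedBayesianGame

/-! ### Realization plans -/

section RealizationPlans

variable {K A B : Type*} [Fintype A] {T : ℕ}

/-- The behavior strategy `σ` as a family indexed by all natural numbers, with the junk value `0`
from stage `T` on. -/
noncomputable def stageProb (σ : Strategy K A B A T) (n : ℕ) (k : K) (hA : Fin n → A)
    (hB : Fin n → B) (a : A) : ℝ :=
  if h : n < T then (σ ⟨n, h⟩ k hA hB).1 a else 0

/-- The realization weight of the histories `hA`, `hB` for the type `k`: the product of the prior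
weight of `k` and of the probabilities with which `σ` plays the actions in `hA`. -/
noncomputable def reach (p : K → ℝ) (σ : Strategy K A B A T) :
    (n : ℕ) → K → (Fin n → A) → (Fin n → B) → ℝ
  | 0, k, _, _ => p k
  | n + 1, k, hA, hB =>
      reach p σ n k (Fin.init (α := fun _ => A) hA) (Fin.init (α := fun _ => B) hB) *
        stageProb σ n k (Fin.init (α := fun _ => A) hA) (Fin.init (α := fun _ => B) hB)
          (hA (Fin.last n))

/-- The realization plan of the behavior strategy `σ`. -/
noncomputable def planOf (p : K → ℝ) (σ : Strategy K A B A T) : Plan K A B A T :=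
  fun t k hA hB a => reach p σ t k hA hB * (σ t k hA hB).1 a

lemma stageProb_fin (σ : Strategy K A B A T) (t : Fin T) (k : K) (hA : Fin t → A)
    (hB : Fin t → B) (a : A) : stageProb σ t k hA hB a = (σ t k hA hB).1 a := by
  simp [stageProb]

lemma stageProb_nonneg (σ : Strategy K A B A T) (n : ℕ) (k : K) (hA : Fin n → A)
    (hB : Fin n → B) (a : A) : 0 ≤ stageProb σ n k hA hB a := by
  unfold stageProb
  split_ifs with h
  · exact (σ ⟨n, h⟩ k hA hB).2.1 a
  · exact le_rfl

lemma sum_stageProb (σ : Strategy K A B A T) {n : ℕ} (hn : n < T) (k : K) (hA : Fin n → A)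
    (hB : Fin n → B) : ∑ a, stageProb σ n k hA hB a = 1 := by
  simpa [stageProb, hn] using (σ ⟨n, hn⟩ k hA hB).2.2

lemma reach_nonneg {p : K → ℝ} (hp : ∀ k, 0 ≤ p k) (σ : Strategy K A B A T) (n : ℕ) (k : K)
    (hA : Fin n → A) (hB : Fin n → B) : 0 ≤ reach p σ n k hA hB := by
  induction n with
  | zero => exact hp k
  | succ n ih => exact mul_nonneg (ih _ _) (stageProb_nonneg ..)

lemma reach_snoc (p : K → ℝ) (σ : Strategy K A B A T) (n : ℕ) (k : K)
    (hA : Fin n → A) (hB : Fin n → B) (a : A) (b : B) :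
    reach p σ (n + 1) k (Fin.snoc (α := fun _ => A) hA a) (Fin.snoc (α := fun _ => B) hB b) =
      reach p σ n k hA hB * stageProb σ n k hA hB a := by
  simp [reach]

/-- The realization weights in the closed form used by `playProb`. -/
lemma reach_eq_prod (p : K → ℝ) (σ : Strategy K A B A T) {n : ℕ} (hn : n ≤ T) (k : K)
    (hA : Fin n → A) (hB : Fin n → B) :
    reach p σ n k hA hB =
      p k * ∏ s : Fin n, stageProb σ s k (Fin.take s s.isLt.le hA) (Fin.take s s.isLt.le hB)
        (hA s) := by
  induction n with
  | zero => simp [reach]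
  | succ n ih =>
    rw [reach, ih (by omega), Fin.prod_univ_castSucc, mul_assoc]
    rfl

lemma prevPlan₁_planOf (p : K → ℝ) (σ : Strategy K A B A T) (t : Fin T) (k : K)
    (hA : Fin t → A) (hB : Fin t → B) :
    prevPlan₁ p (planOf p σ) t k hA hB = reach p σ t k hA hB := by
  obtain ⟨t, ht⟩ := t
  cases t with
  | zero => rfl
  | succ t =>
    simp only [prevPlan₁, prevEntry, planOf, reach]
    exact congrArg _ (stageProb_fin σ ⟨t, _⟩ ..).symm

lemma isRealizationPlan₁_planOf {p : K → ℝ} (hp : ∀ k, 0 ≤ p k) (σ : Strategy K A B A T) :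
    IsRealizationPlan₁ p (planOf p σ) := by
  refine ⟨fun t k hA hB => ?_, fun t k hA hB a => ?_⟩
  · rw [prevPlan₁_planOf]
    simp only [planOf]
    rw [← Finset.mul_sum, (σ t k hA hB).2.2, mul_one]
  · exact mul_nonneg (reach_nonneg hp ..) ((σ t k hA hB).2.1 a)

lemma isRatioStrategy₁_planOf (p : K → ℝ) (σ : Strategy K A B A T) :
    IsRatioStrategy₁ p (planOf p σ) σ := by
  intro t k hA hB h a
  rw [prevPlan₁_planOf] at h ⊢
  rw [planOf, mul_div_cancel_left₀ _ h]

/-- A realization plan vanishes wherever its preceding entry does, so the ratios determine it. -/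
lemma IsRatioStrategy₁.eq_planOf {p : K → ℝ} {x : Plan K A B A T} {σ : Strategy K A B A T}
    (h : IsRatioStrategy₁ p x σ) (hx : IsRealizationPlan₁ p x) : x = planOf p σ := by
  have step : ∀ t k hA hB a, x t k hA hB a = prevPlan₁ p x t k hA hB * (σ t k hA hB).1 a := by
    intro t k hA hB a
    by_cases h0 : prevPlan₁ p x t k hA hB = 0
    · have hs := hx.1 t k hA hB
      rw [h0, Finset.sum_eq_zero_iff_of_nonneg fun a _ => hx.2 t k hA hB a] at hs
      rw [h0, zero_mul, hs a (Finset.mem_univ a)]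
    · rw [h t k hA hB h0 a, mul_div_cancel₀ _ h0]
  have prev : ∀ (n : ℕ) (hn : n < T) k hA hB,
      prevPlan₁ p x ⟨n, hn⟩ k hA hB = reach p σ n k hA hB := by
    intro n
    induction n with
    | zero => intros; rfl
    | succ n ih =>
      intro hn k hA hB
      have := step ⟨n, by omega⟩ k (Fin.init (α := fun _ => A) hA)
        (Fin.init (α := fun _ => B) hB) (hA (Fin.last n))
      rw [ih, ← stageProb_fin] at this
      exact this
  funext t k hA hB a
  rw [step, prev t t.isLt]
  rfl

lemma IsRealizationPlan₁.exists_isRatioStrategy₁ [Nonempty A] {p : K → ℝ} {x : Plan K A B A T}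
    (hx : IsRealizationPlan₁ p x) : ∃ σ : Strategy K A B A T, IsRatioStrategy₁ p x σ := by
  classical
  have key : ∀ t k hA hB, ∃ s : stdSimplex ℝ A, prevPlan₁ p x t k hA hB ≠ 0 →
      ∀ a, s.1 a = x t k hA hB a / prevPlan₁ p x t k hA hB := by
    intro t k hA hB
    by_cases h0 : prevPlan₁ p x t k hA hB = 0
    · exact ⟨⟨_, single_mem_stdSimplex ℝ (Classical.arbitrary A)⟩, fun h => absurd h0 h⟩
    · refine ⟨⟨fun a => x t k hA hB a / prevPlan₁ p x t k hA hB, fun a => ?_, ?_⟩,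
        fun _ _ => rfl⟩
      · refine div_nonneg (hx.2 ..) ?_
        rw [← hx.1]
        exact Finset.sum_nonneg fun a _ => hx.2 ..
      · rw [← Finset.sum_div, hx.1, div_self h0]
  choose σ hσ using key
  exact ⟨σ, hσ⟩

end RealizationPlans

/-! ### The payoff along continuation values -/

section Payoff

variable {K L A B : Type*} [Fintype A] [Fintype B] {T : ℕ}

/-- A strategy with the histories of the two players listed in the opposite order. A strategy of
player 2 becomes a strategy of player 1 in the game with the roles exchanged. -/
def Strategy.swap {Θ A B C : Type*} [Fintype C] {T : ℕ} (τ : Strategy Θ A B C T) :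
    Strategy Θ B A C T :=
  fun t l hB hA => τ t l hA hB

lemma playProb_eq (p : K → ℝ) (q : L → ℝ) (σ : Strategy K A B A T) (τ : Strategy L A B B T)
    (k : K) (l : L) (a : Fin T → A) (b : Fin T → B) :
    playProb p q σ τ k l a b = reach p σ T k a b * reach q τ.swap T l b a := by
  rw [reach_eq_prod p σ le_rfl, reach_eq_prod q τ.swap le_rfl, mul_mul_mul_comm,
    ← Finset.prod_mul_distrib]
  simp only [playProb, stageProb_fin]
  rfl

lemma sum_snoc {n : ℕ} (f : (Fin (n + 1) → A) → ℝ) :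
    ∑ h, f h = ∑ h : Fin n → A, ∑ a, f (Fin.snoc (α := fun _ => A) h a) := by
  rw [Finset.sum_comm,
    ← Fintype.sum_prod_type' (f := fun a h => f (Fin.snoc (α := fun _ => A) h a))]
  exact (Fintype.sum_equiv (Fin.snocEquiv fun _ => A) _ _ fun _ => rfl).symm

lemma sum_snoc₂ {n : ℕ} (f : (Fin (n + 1) → A) → (Fin (n + 1) → B) → ℝ) :
    ∑ hA, ∑ hB, f hA hB = ∑ hA : Fin n → A, ∑ hB : Fin n → B, ∑ a, ∑ b,
      f (Fin.snoc (α := fun _ => A) hA a) (Fin.snoc (α := fun _ => B) hB b) := by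
  simp_rw [sum_snoc]
  exact Finset.sum_congr rfl fun _ _ => Finset.sum_comm

/-- The part of the payoff that is earned at the first `n` stages when player 2 has type `l`. -/
noncomputable def partialPayoff [Fintype K] (M : K → L → A → B → ℝ) (p : K → ℝ) (q : L → ℝ)
    (σ : Strategy K A B A T) (τ : Strategy L A B B T) (l : L) (n : ℕ) : ℝ :=
  ∑ k, ∑ hA : Fin n → A, ∑ hB : Fin n → B,
    reach p σ n k hA hB * reach q τ.swap n l hB hA * ∑ t : Fin n, M k l (hA t) (hB t)

lemma payoff_eq_sum_partialPayoff [Fintype K] [Fintype L] (M : K → L → A → B → ℝ) (p : K → ℝ)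
    (q : L → ℝ) (σ : Strategy K A B A T) (τ : Strategy L A B B T) :
    payoff M p q σ τ = ∑ l, partialPayoff M p q σ τ l T := by
  simp only [payoff, partialPayoff, playProb_eq]
  exact Finset.sum_comm

/-- The sum of the continuation values `v` at stage `n`, weighted with the realization weights of
player 2. Those of player 1 are thought of as contained in `v`. -/
noncomputable def continuationTotal (q : L → ℝ) (τ : Strategy L A B B T)
    (v : (n : ℕ) → L → (Fin n → A) → (Fin n → B) → ℝ) (l : L) (n : ℕ) : ℝ :=
  ∑ hA, ∑ hB, reach q τ.swap n l hB hA * v n l hA hB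

/-- What the action `b` brings at stage `n` to the type `l` of player 2: the current payoff,
weighted with the realization weights of player 1, plus the continuation values `v`. -/
noncomputable def actionValue [Fintype K] (M : K → L → A → B → ℝ) (p : K → ℝ)
    (σ : Strategy K A B A T) (v : (n : ℕ) → L → (Fin n → A) → (Fin n → B) → ℝ) (n : ℕ) (l : L)
    (hA : Fin n → A) (hB : Fin n → B) (b : B) : ℝ :=
  (∑ k, ∑ a, M k l a b * (reach p σ n k hA hB * stageProb σ n k hA hB a)) +
    ∑ a, v (n + 1) l (Fin.snoc (α := fun _ => A) hA a) (Fin.snoc (α := fun _ => B) hB b)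

lemma partialPayoff_succ [Fintype K] (M : K → L → A → B → ℝ) (p : K → ℝ) (q : L → ℝ)
    (σ : Strategy K A B A T) (τ : Strategy L A B B T) (l : L) {n : ℕ} (hn : n < T) :
    partialPayoff M p q σ τ l (n + 1) = partialPayoff M p q σ τ l n +
      ∑ hA : Fin n → A, ∑ hB : Fin n → B, reach q τ.swap n l hB hA *
        ∑ b, stageProb τ.swap n l hB hA b *
          ∑ k, ∑ a, M k l a b * (reach p σ n k hA hB * stageProb σ n k hA hB a) := by
  have h2 : ∑ hA : Fin n → A, ∑ hB : Fin n → B, reach q τ.swap n l hB hA *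
        ∑ b, stageProb τ.swap n l hB hA b *
          ∑ k, ∑ a, M k l a b * (reach p σ n k hA hB * stageProb σ n k hA hB a) =
      ∑ k, ∑ hA : Fin n → A, ∑ hB : Fin n → B, reach q τ.swap n l hB hA *
        ∑ b, stageProb τ.swap n l hB hA b *
          ∑ a, M k l a b * (reach p σ n k hA hB * stageProb σ n k hA hB a) := by
    rw [eq_comm, Finset.sum_comm]
    refine Finset.sum_congr rfl fun hA _ => ?_
    rw [Finset.sum_comm]
    refine Finset.sum_congr rfl fun hB _ => ?_
    rw [← Finset.mul_sum, Finset.sum_comm]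
    simp_rw [Finset.mul_sum]
  rw [h2]
  unfold partialPayoff
  rw [← Finset.sum_add_distrib]
  refine Finset.sum_congr rfl fun k _ => ?_
  rw [sum_snoc₂, ← Finset.sum_add_distrib]
  refine Finset.sum_congr rfl fun hA _ => ?_
  rw [← Finset.sum_add_distrib]
  refine Finset.sum_congr rfl fun hB _ => ?_
  simp only [reach_snoc, Fin.sum_univ_castSucc, Fin.snoc_castSucc, Fin.snoc_last]
  set R := reach p σ n k hA hB
  set S := reach q τ.swap n l hB hA
  set m := ∑ t : Fin n, M k l (hA t) (hB t)
  -- The actions of stage `n` have total probability one, so they may be inserted into the payoff of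
  -- the earlier stages.
  have h1 : R * S * m = ∑ a, ∑ b, stageProb σ n k hA hB a * stageProb τ.swap n l hB hA b *
      (R * S * m) := by
    simp_rw [← Finset.sum_mul, ← Finset.mul_sum, sum_stageProb τ.swap hn, mul_one,
      sum_stageProb σ hn, one_mul]
  rw [h1]
  simp_rw [Finset.mul_sum]
  conv_rhs => rw [add_comm, Finset.sum_comm, ← Finset.sum_add_distrib]
  refine Finset.sum_congr rfl fun a _ => ?_
  rw [← Finset.sum_add_distrib]
  refine Finset.sum_congr rfl fun b _ => ?_
  ring

lemma continuationTotal_succ (q : L → ℝ) (τ : Strategy L A B B T)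
    (v : (n : ℕ) → L → (Fin n → A) → (Fin n → B) → ℝ) (l : L) (n : ℕ) :
    continuationTotal q τ v l (n + 1) =
      ∑ hA : Fin n → A, ∑ hB : Fin n → B, reach q τ.swap n l hB hA *
        ∑ b, stageProb τ.swap n l hB hA b *
          ∑ a, v (n + 1) l (Fin.snoc (α := fun _ => A) hA a)
            (Fin.snoc (α := fun _ => B) hB b) := by
  unfold continuationTotal
  rw [sum_snoc₂]
  refine Finset.sum_congr rfl fun hA _ => Finset.sum_congr rfl fun hB _ => ?_
  rw [Finset.sum_comm]
  simp only [reach_snoc, Finset.mul_sum, mul_assoc]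

/-- Replacing, at stage `n`, the continuation value by the stage payoff and the next continuation
values changes the total by the gap between `actionValue` and `v`, averaged with the weights of
player 2. -/
lemma partialPayoff_add_continuationTotal_succ [Fintype K] (M : K → L → A → B → ℝ) (p : K → ℝ)
    (q : L → ℝ) (σ : Strategy K A B A T) (τ : Strategy L A B B T)
    (v : (n : ℕ) → L → (Fin n → A) → (Fin n → B) → ℝ) (l : L) {n : ℕ} (hn : n < T) :
    partialPayoff M p q σ τ l (n + 1) + continuationTotal q τ v l (n + 1) =
      partialPayoff M p q σ τ l n + continuationTotal q τ v l n +
        ∑ hA : Fin n → A, ∑ hB : Fin n → B, reach q τ.swap n l hB hA *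
          ∑ b, stageProb τ.swap n l hB hA b * (actionValue M p σ v n l hA hB b - v n l hA hB) := by
  rw [partialPayoff_succ M p q σ τ l hn, continuationTotal_succ]
  unfold continuationTotal actionValue
  rw [add_assoc, add_assoc, ← Finset.sum_add_distrib, ← Finset.sum_add_distrib]
  congr 1
  refine Finset.sum_congr rfl fun hA _ => ?_
  rw [← Finset.sum_add_distrib, ← Finset.sum_add_distrib]
  refine Finset.sum_congr rfl fun hB _ => ?_
  simp only [mul_sub, mul_add, Finset.sum_sub_distrib, Finset.sum_add_distrib]
  rw [← Finset.sum_mul, sum_stageProb τ.swap hn]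
  ring

lemma partialPayoff_add_continuationTotal_zero [Fintype K] (M : K → L → A → B → ℝ) (p : K → ℝ)
    (q : L → ℝ) (σ : Strategy K A B A T) (τ : Strategy L A B B T)
    (v : (n : ℕ) → L → (Fin n → A) → (Fin n → B) → ℝ) (l : L) :
    partialPayoff M p q σ τ l 0 + continuationTotal q τ v l 0 =
      q l * v 0 l Fin.elim0 Fin.elim0 := by
  simp only [partialPayoff, continuationTotal, reach, Finset.univ_eq_empty, Finset.sum_empty,
    mul_zero, Finset.sum_const_zero, zero_add, Fintype.sum_unique]
  congr!

lemma payoff_eq_of_terminal [Fintype K] [Fintype L] (M : K → L → A → B → ℝ) (p : K → ℝ) (q : L → ℝ)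
    (σ : Strategy K A B A T) (τ : Strategy L A B B T)
    (v : (n : ℕ) → L → (Fin n → A) → (Fin n → B) → ℝ) (hv : ∀ l hA hB, v T l hA hB = 0) :
    payoff M p q σ τ =
      ∑ l, (partialPayoff M p q σ τ l T + continuationTotal q τ v l T) := by
  simp [payoff_eq_sum_partialPayoff, continuationTotal, hv]

/-- Continuation values that no action of player 2 can undercut bound the payoff from below. -/
lemma sum_le_payoff [Fintype K] [Fintype L] (M : K → L → A → B → ℝ) (p : K → ℝ) {q : L → ℝ}
    (hq : ∀ l, 0 ≤ q l) (σ : Strategy K A B A T) (τ : Strategy L A B B T)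
    (v : (n : ℕ) → L → (Fin n → A) → (Fin n → B) → ℝ) (hv : ∀ l hA hB, v T l hA hB = 0)
    (hle : ∀ n < T, ∀ l hA hB b, v n l hA hB ≤ actionValue M p σ v n l hA hB b) :
    ∑ l, q l * v 0 l Fin.elim0 Fin.elim0 ≤ payoff M p q σ τ := by
  rw [payoff_eq_of_terminal M p q σ τ v hv]
  refine Finset.sum_le_sum fun l _ => ?_
  rw [← partialPayoff_add_continuationTotal_zero M p q σ τ v l]
  suffices h : ∀ n ≤ T, partialPayoff M p q σ τ l 0 + continuationTotal q τ v l 0 ≤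
      partialPayoff M p q σ τ l n + continuationTotal q τ v l n from h T le_rfl
  intro n
  induction n with
  | zero => exact fun _ => le_rfl
  | succ n ih =>
    intro hn
    rw [partialPayoff_add_continuationTotal_succ M p q σ τ v l hn]
    refine (ih (by omega)).trans (le_add_of_nonneg_right ?_)
    exact Finset.sum_nonneg fun hA _ => Finset.sum_nonneg fun hB _ =>
      mul_nonneg (reach_nonneg hq ..) <| Finset.sum_nonneg fun b _ =>
        mul_nonneg (stageProb_nonneg ..) (sub_nonneg.2 (hle n hn l hA hB b))

/-- If `τ` plays only actions that attain the continuation values, these give the payoff. -/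
lemma payoff_eq_sum [Fintype K] [Fintype L] (M : K → L → A → B → ℝ) (p : K → ℝ) (q : L → ℝ)
    (σ : Strategy K A B A T) (τ : Strategy L A B B T)
    (v : (n : ℕ) → L → (Fin n → A) → (Fin n → B) → ℝ) (hv : ∀ l hA hB, v T l hA hB = 0)
    (heq : ∀ n < T, ∀ l hA hB b, stageProb τ.swap n l hB hA b ≠ 0 →
      actionValue M p σ v n l hA hB b = v n l hA hB) :
    payoff M p q σ τ = ∑ l, q l * v 0 l Fin.elim0 Fin.elim0 := by
  rw [payoff_eq_of_terminal M p q σ τ v hv]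
  refine Finset.sum_congr rfl fun l _ => ?_
  rw [← partialPayoff_add_continuationTotal_zero M p q σ τ v l]
  suffices h : ∀ n ≤ T, partialPayoff M p q σ τ l n + continuationTotal q τ v l n =
      partialPayoff M p q σ τ l 0 + continuationTotal q τ v l 0 from h T le_rfl
  intro n
  induction n with
  | zero => exact fun _ => rfl
  | succ n ih =>
    intro hn
    rw [partialPayoff_add_continuationTotal_succ M p q σ τ v l hn, ih (by omega), add_eq_left]
    refine Finset.sum_eq_zero fun hA _ => Finset.sum_eq_zero fun hB _ => ?_
    refine mul_eq_zero_of_right _ (Finset.sum_eq_zero fun b _ => ?_)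
    by_cases hb : stageProb τ.swap n l hB hA b = 0
    · rw [hb, zero_mul]
    · rw [heq n hn l hA hB b hb, sub_self, mul_zero]

end Payoff

/-! ### The linear program of player 1 -/

section LinearProgram

variable {K L A B : Type*} [Fintype K] [Fintype A] {T : ℕ}

/-- The variables `u₀`, `u` of the linear program as continuation values indexed by the history
before which they are due; they vanish after the last stage. -/
def continuationOf (u : Continuation L A B T) (u₀ : L → ℝ) :
    (n : ℕ) → L → (Fin n → A) → (Fin n → B) → ℝ
  | 0, l, _, _ => u₀ l
  | n + 1, l, hA, hB =>
      if h : n + 1 < T then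
        u ⟨n, Nat.lt_of_succ_lt h⟩ l (Fin.init (α := fun _ => A) hA)
          (Fin.init (α := fun _ => B) hB) (hA (Fin.last n)) (hB (Fin.last n))
      else 0

omit [Fintype A] in
lemma prevEntry_eq_continuationOf (u : Continuation L A B T) (u₀ : L → ℝ) (t : Fin T) (l : L)
    (hA : Fin t → A) (hB : Fin t → B) :
    prevEntry (u₀ l) (fun s gA gB => u s l gA gB) t hA hB = continuationOf u u₀ t l hA hB := by
  obtain ⟨t, ht⟩ := t
  cases t with
  | zero => rfl
  | succ t => simp [prevEntry, continuationOf, ht]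

variable [Fintype L] [Fintype B]

/-- Weak duality: the objective of a feasible point is at most the payoff of any strategy that
realizes its plan, whatever player 2 does. -/
lemma PrimalFeasible.sum_le_payoff {M : K → L → A → B → ℝ} {p : K → ℝ} {q : L → ℝ}
    (hT : 1 ≤ T) (hq : ∀ l, 0 ≤ q l) {x : Plan K A B A T} {u : Continuation L A B T} {u₀ : L → ℝ}
    (h : PrimalFeasible M p x u u₀) {σ : Strategy K A B A T} (hσ : IsRatioStrategy₁ p x σ)
    (τ : Strategy L A B B T) : ∑ l, q l * u₀ l ≤ payoff M p q σ τ := by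
  obtain rfl := hσ.eq_planOf h.plan
  refine RepeatedBayesianGame.sum_le_payoff M p hq σ τ (continuationOf u u₀) ?_ ?_
  · intro l hA hB
    obtain ⟨n, rfl⟩ := Nat.exists_eq_add_of_le' hT
    simp [continuationOf]
  · intro n hn l hA hB b
    rw [← prevEntry_eq_continuationOf u u₀ ⟨n, hn⟩]
    refine (h.bound ⟨n, hn⟩ l hA hB b).trans (le_of_eq ?_)
    unfold actionValue planOf
    congr 1
    · simp [stageProb, hn]
    · refine Finset.sum_congr rfl fun a _ => ?_
      by_cases hn' : n + 1 < T
      · simp [continuationOf, hn']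
      · rw [h.terminal ⟨n, hn⟩ (show n + 1 = T by omega)]
        simp [continuationOf, hn']

/-- The least continuation payoff that the type `l` of player 2 can achieve against `σ` after the
histories `hA`, `hB`, by backward induction. Future payoffs are weighted with the realization
weights of player 1 and not normalized. -/
noncomputable def bestResponseValue (M : K → L → A → B → ℝ) (p : K → ℝ) (σ : Strategy K A B A T)
    (n : ℕ) (l : L) (hA : Fin n → A) (hB : Fin n → B) : ℝ :=
  if n < T then
    ⨅ b, ((∑ k, ∑ a, M k l a b * (reach p σ n k hA hB * stageProb σ n k hA hB a)) +
      ∑ a, bestResponseValue M p σ (n + 1) l (Fin.snoc (α := fun _ => A) hA a)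
        (Fin.snoc (α := fun _ => B) hB b))
  else 0
termination_by T - n

omit [Fintype L] [Fintype B] in
lemma bestResponseValue_of_lt (M : K → L → A → B → ℝ) (p : K → ℝ) (σ : Strategy K A B A T)
    {n : ℕ} (hn : n < T) (l : L) (hA : Fin n → A) (hB : Fin n → B) :
    bestResponseValue M p σ n l hA hB =
      ⨅ b, actionValue M p σ (bestResponseValue M p σ) n l hA hB b := by
  rw [bestResponseValue, if_pos hn]
  rfl

omit [Fintype L] [Fintype B] in
lemma bestResponseValue_terminal (M : K → L → A → B → ℝ) (p : K → ℝ) (σ : Strategy K A B A T)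
    {n : ℕ} (hn : T ≤ n) (l : L) (hA : Fin n → A) (hB : Fin n → B) :
    bestResponseValue M p σ n l hA hB = 0 := by
  rw [bestResponseValue, if_neg hn.not_gt]

/-- Strong duality against a fixed `σ`: some completion of its realization plan to a feasible point
has as objective the payoff of `σ` against some (best) response. -/
lemma exists_primalFeasible_planOf [Nonempty B] (M : K → L → A → B → ℝ) {p : K → ℝ}
    (hp : ∀ k, 0 ≤ p k) (q : L → ℝ) (σ : Strategy K A B A T) :
    ∃ (u : Continuation L A B T) (u₀ : L → ℝ) (τ : Strategy L A B B T),
      PrimalFeasible M p (planOf p σ) u u₀ ∧ payoff M p q σ τ = ∑ l, q l * u₀ l := by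
  classical
  set v := bestResponseValue M p σ with hv
  have hmin : ∀ (t : Fin T) l hA hB, ∃ b,
      actionValue M p σ v t l hA hB b = v t l hA hB := by
    intro t l hA hB
    rw [hv, bestResponseValue_of_lt M p σ t.isLt]
    exact exists_eq_ciInf_of_finite
  choose β hβ using hmin
  -- The response `τ` plays the minimizing action `β` with probability one.
  refine ⟨fun t l hA hB a b => v (t + 1) l (Fin.snoc (α := fun _ => A) hA a)
    (Fin.snoc (α := fun _ => B) hB b), fun l => v 0 l Fin.elim0 Fin.elim0,
    fun t l hA hB => ⟨_, single_mem_stdSimplex ℝ (β t l hA hB)⟩,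
    ⟨isRealizationPlan₁_planOf hp σ, ?_, ?_⟩, ?_⟩
  · intro t ht l hA hB a b
    exact bestResponseValue_terminal M p σ ht.ge ..
  · intro t l hA hB b
    have hprev : prevEntry (v 0 l Fin.elim0 Fin.elim0) (fun s gA gB a b =>
        v (s + 1) l (Fin.snoc (α := fun _ => A) gA a) (Fin.snoc (α := fun _ => B) gB b)) t hA hB =
        v t l hA hB := by
      obtain ⟨t, ht⟩ := t
      cases t with
      | zero =>
        simp only [prevEntry]
        congr!
      | succ t => simp [prevEntry]
    rw [hprev, hv, bestResponseValue_of_lt M p σ t.isLt]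
    refine (ciInf_le (Set.finite_range _).bddBelow b).trans (le_of_eq ?_)
    simp only [actionValue, planOf, stageProb_fin]
  · refine payoff_eq_sum M p q σ _ v (bestResponseValue_terminal M p σ le_rfl) ?_
    intro n hn l hA hB b hb
    have : b = β ⟨n, hn⟩ l hA hB := by
      by_contra hne
      simp [stageProb, hn, Strategy.swap, hne] at hb
    rw [this]
    exact hβ ⟨n, hn⟩ l hA hB

/-- Every strategy of player 1 has a guarantee, and this is the greatest objective of the feasible
points that complete its realization plan. -/
lemma exists_isLeast_payoff [Nonempty B] (M : K → L → A → B → ℝ) {p : K → ℝ} (hT : 1 ≤ T)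
    (hp : ∀ k, 0 ≤ p k) {q : L → ℝ} (hq : ∀ l, 0 ≤ q l) (σ : Strategy K A B A T) :
    ∃ (u : Continuation L A B T) (u₀ : L → ℝ), PrimalFeasible M p (planOf p σ) u u₀ ∧
      IsLeast (Set.range fun τ : Strategy L A B B T => payoff M p q σ τ) (∑ l, q l * u₀ l) := by
  obtain ⟨u, u₀, τ, hf, he⟩ := exists_primalFeasible_planOf M hp q σ
  refine ⟨u, u₀, hf, ⟨τ, he⟩, ?_⟩
  rintro _ ⟨τ', rfl⟩
  exact hf.sum_le_payoff hT hq (isRatioStrategy₁_planOf p σ) τ'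

/-- Feasible points cannot do better than the security level. -/
lemma PrimalFeasible.sum_le [Nonempty A] [Nonempty B] {M : K → L → A → B → ℝ} {p : K → ℝ}
    {q : L → ℝ} (hT : 1 ≤ T) (hp : ∀ k, 0 ≤ p k) (hq : ∀ l, 0 ≤ q l) {V : ℝ}
    (hV : IsSecurityLevel₁ M T p q V) {x : Plan K A B A T} {u : Continuation L A B T} {u₀ : L → ℝ}
    (h : PrimalFeasible M p x u u₀) : ∑ l, q l * u₀ l ≤ V := by
  obtain ⟨σ, hσ⟩ := h.plan.exists_isRatioStrategy₁
  obtain ⟨u', u₀', -, hl⟩ := exists_isLeast_payoff M hT hp hq σ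
  obtain ⟨τ, hτ⟩ := hl.1
  calc ∑ l, q l * u₀ l ≤ payoff M p q σ τ := h.sum_le_payoff hT hq hσ τ
    _ = ∑ l, q l * u₀' l := hτ
    _ ≤ V := hV.2 ⟨σ, hl⟩

/-- The linear program of player 1 computes the security level. -/
lemma isGreatest_primal [Nonempty A] [Nonempty B] {M : K → L → A → B → ℝ} {p : K → ℝ}
    {q : L → ℝ} (hT : 1 ≤ T) (hp : ∀ k, 0 ≤ p k) (hq : ∀ l, 0 ≤ q l) {V : ℝ}
    (hV : IsSecurityLevel₁ M T p q V) :
    IsGreatest {v : ℝ | ∃ (x : Plan K A B A T) (u : Continuation L A B T) (u₀ : L → ℝ),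
      PrimalFeasible M p x u u₀ ∧ v = ∑ l : L, q l * u₀ l} V := by
  refine ⟨?_, ?_⟩
  · obtain ⟨σ, hσ⟩ := hV.1
    obtain ⟨u, u₀, hf, hl⟩ := exists_isLeast_payoff M hT hp hq σ
    exact ⟨_, u, u₀, hf, hσ.unique hl⟩
  · rintro _ ⟨x, u, u₀, hf, rfl⟩
    exact hf.sum_le hT hp hq hV

/-- The security strategies of player 1 are those given by the ratios of an optimal solution. -/
lemma isSecurityStrategy₁_iff [Nonempty A] [Nonempty B] {M : K → L → A → B → ℝ} {p : K → ℝ}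
    {q : L → ℝ} (hT : 1 ≤ T) (hp : ∀ k, 0 ≤ p k) (hq : ∀ l, 0 ≤ q l) {V : ℝ}
    (hV : IsSecurityLevel₁ M T p q V) (σ : Strategy K A B A T) :
    IsSecurityStrategy₁ M p q σ ↔
      ∃ (x : Plan K A B A T) (u : Continuation L A B T) (u₀ : L → ℝ),
        PrimalOptimal M p q x u u₀ ∧ IsRatioStrategy₁ p x σ := by
  constructor
  · rintro ⟨v, hv, hσ⟩
    obtain ⟨u, u₀, hf, hl⟩ := exists_isLeast_payoff M hT hp hq σ
    refine ⟨planOf p σ, u, u₀, ⟨hf, fun x' u' u₀' h' => ?_⟩, isRatioStrategy₁_planOf p σ⟩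
    rw [hl.unique hσ]
    exact h'.sum_le hT hp hq hv
  · rintro ⟨x, u, u₀, ⟨hf, hopt⟩, hσ⟩
    obtain ⟨x', u', u₀', hf', hV'⟩ := (isGreatest_primal hT hp hq hV).1
    have hle : V ≤ ∑ l, q l * u₀ l := hV' ▸ hopt x' u' u₀' hf'
    obtain ⟨u'', u₀'', -, hl⟩ := exists_isLeast_payoff M hT hp hq σ
    obtain ⟨τ, hτ⟩ := hl.1
    have h1 : ∑ l, q l * u₀'' l = V :=
      le_antisymm (hV.2 ⟨σ, hl⟩) (hle.trans (hτ ▸ hf.sum_le_payoff hT hq hσ τ))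
    exact ⟨V, hV, h1 ▸ hl⟩

end LinearProgram

/-! ### Exchanging the roles of the players -/

section Exchange

variable {K L A B : Type*} {T : ℕ}

/-- The stage payoffs of the game with the roles of the players exchanged. -/
def exchange (M : K → L → A → B → ℝ) : L → K → B → A → ℝ := fun l k b a => -M k l a b

/-- A plan with the histories of the two players listed in the opposite order. -/
def Plan.swap {Θ A B C : Type*} {T : ℕ} (y : Plan Θ A B C T) : Plan Θ B A C T :=
  fun t l hB hA => y t l hA hB

/-- The continuation variables of one player's program as those of the other player in the game
with the roles exchanged. -/
def Continuation.exchange {Θ A B : Type*} {T : ℕ} (w : Continuation Θ A B T) :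
    Continuation Θ B A T :=
  fun t k hB hA b a => -w t k hA hB a b

lemma Continuation.exchange_exchange (w : Continuation K A B T) : w.exchange.exchange = w := by
  funext t k hA hB a b
  exact neg_neg _

lemma prevPlan₂_eq_swap (q : L → ℝ) (y : Plan L A B B T) (t : Fin T) (l : L) (hA : Fin t → A)
    (hB : Fin t → B) : prevPlan₂ q y t l hA hB = prevPlan₁ q y.swap t l hB hA := by
  obtain ⟨_ | t, ht⟩ := t <;> rfl

lemma prevEntry_exchange (w : Continuation K A B T) (w₀ : K → ℝ) (t : Fin T) (k : K)
    (hA : Fin t → A) (hB : Fin t → B) :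
    prevEntry ((-w₀) k) (fun s gB gA => w.exchange s k gB gA) t hB hA =
      -prevEntry (w₀ k) (fun s gA gB => w s k gA gB) t hA hB := by
  obtain ⟨_ | t, ht⟩ := t <;> rfl

lemma isRatioStrategy₂_iff [Fintype B] (q : L → ℝ) (y : Plan L A B B T) (τ : Strategy L A B B T) :
    IsRatioStrategy₂ q y τ ↔ IsRatioStrategy₁ q y.swap τ.swap := by
  simp only [IsRatioStrategy₂, IsRatioStrategy₁, prevPlan₂_eq_swap]
  exact ⟨fun h t l hB hA => h t l hA hB, fun h t l hA hB => h t l hB hA⟩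

lemma isRealizationPlan₂_iff [Fintype B] (q : L → ℝ) (y : Plan L A B B T) :
    IsRealizationPlan₂ q y ↔ IsRealizationPlan₁ q y.swap := by
  simp only [IsRealizationPlan₂, IsRealizationPlan₁, prevPlan₂_eq_swap]
  exact ⟨fun h => ⟨fun t l hB hA => h.1 t l hA hB, fun t l hB hA => h.2 t l hA hB⟩,
    fun h => ⟨fun t l hA hB => h.1 t l hB hA, fun t l hA hB => h.2 t l hB hA⟩⟩

variable [Fintype L] [Fintype B]

lemma dualFeasible_iff (M : K → L → A → B → ℝ) (q : L → ℝ) (y : Plan L A B B T)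
    (w : Continuation K A B T) (w₀ : K → ℝ) :
    DualFeasible M q y w w₀ ↔ PrimalFeasible (exchange M) q y.swap w.exchange (-w₀) := by
  have hb : ∀ (t : Fin T) (k : K) (hA : Fin t → A) (hB : Fin t → B) (a : A),
      (∑ l, ∑ b, exchange M l k b a * y.swap t l hB hA b) + ∑ b, w.exchange t k hB hA b a =
        -((∑ l, ∑ b, M k l a b * y t l hA hB b) + ∑ b, w t k hA hB a b) := by
    intro t k hA hB a
    simp only [exchange, Plan.swap, Continuation.exchange, neg_mul, Finset.sum_neg_distrib]
    ring
  constructor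
  · rintro ⟨h1, h2, h3⟩
    refine ⟨(isRealizationPlan₂_iff q y).1 h1, fun t ht k hB hA b a => ?_,
      fun t k hB hA a => ?_⟩
    · simp [Continuation.exchange, h2 t ht]
    · rw [hb, prevEntry_exchange]
      exact neg_le_neg (h3 t k hA hB a)
  · rintro ⟨h1, h2, h3⟩
    refine ⟨(isRealizationPlan₂_iff q y).2 h1, fun t ht k hA hB a b => ?_,
      fun t k hA hB a => ?_⟩
    · exact neg_eq_zero.1 (h2 t ht k hB hA b a)
    · have := h3 t k hB hA a
      rw [hb, prevEntry_exchange] at this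
      exact neg_le_neg_iff.1 this

/-- Every feasible point of the program of player 1 in the exchanged game comes from one of the
program of player 2. -/
lemma dualFeasible_of_exchange {M : K → L → A → B → ℝ} {q : L → ℝ} {y : Plan L B A B T}
    {w : Continuation K B A T} {w₀ : K → ℝ} (h : PrimalFeasible (exchange M) q y w w₀) :
    DualFeasible M q y.swap w.exchange (-w₀) := by
  rw [dualFeasible_iff, neg_neg, w.exchange_exchange]
  exact h

lemma dualOptimal_iff [Fintype K] (M : K → L → A → B → ℝ) (p : K → ℝ) (q : L → ℝ)
    (y : Plan L A B B T) (w : Continuation K A B T) (w₀ : K → ℝ) :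
    DualOptimal M p q y w w₀ ↔
      PrimalOptimal (exchange M) q p y.swap w.exchange (-w₀) := by
  have hneg : ∀ z : K → ℝ, ∑ k, p k * (-z) k = -∑ k, p k * z k := by simp
  simp only [DualOptimal, PrimalOptimal, dualFeasible_iff M q y w w₀, hneg]
  refine and_congr_right fun _ => ⟨fun h y' w' w₀' h' => ?_, fun h y' w' w₀' h' => ?_⟩
  · have := h _ _ _ (dualFeasible_of_exchange h')
    rw [hneg] at this
    exact le_neg_of_le_neg this
  · have := h _ _ _ ((dualFeasible_iff M q y' w' w₀').1 h')
    rw [hneg] at this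
    exact neg_le_neg_iff.1 this

variable [Fintype K] [Fintype A]

lemma payoff_exchange (M : K → L → A → B → ℝ) (p : K → ℝ) (q : L → ℝ) (σ : Strategy K A B A T)
    (τ : Strategy L A B B T) :
    payoff (exchange M) q p τ.swap σ.swap = -payoff M p q σ τ := by
  have : ∀ l k b a, playProb q p τ.swap σ.swap l k b a = playProb p q σ τ k l a b := by
    intro l k b a
    rw [playProb_eq, playProb_eq, mul_comm]
    rfl
  simp only [payoff, this, exchange, Finset.sum_neg_distrib, mul_neg]
  rw [Finset.sum_comm]
  exact congrArg _ (Finset.sum_congr rfl fun k _ => Finset.sum_congr rfl fun l _ =>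
    Finset.sum_comm)

lemma isGreatest_payoff_iff (M : K → L → A → B → ℝ) (p : K → ℝ) (q : L → ℝ)
    (τ : Strategy L A B B T) (c : ℝ) :
    IsGreatest (Set.range fun σ : Strategy K A B A T => payoff M p q σ τ) c ↔
      IsLeast (Set.range fun σ : Strategy K B A A T => payoff (exchange M) q p τ.swap σ) (-c) := by
  have key : ∀ σ : Strategy K B A A T,
      payoff (exchange M) q p τ.swap σ = -payoff M p q σ.swap τ := fun σ =>
    payoff_exchange M p q σ.swap τ
  constructor
  · rintro ⟨⟨σ, hσ⟩, h⟩
    refine ⟨⟨σ.swap, ?_⟩, ?_⟩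
    · exact (key _).trans (congrArg _ hσ)
    · rintro _ ⟨σ', rfl⟩
      exact (neg_le_neg (h ⟨σ'.swap, rfl⟩)).trans (key σ').ge
  · rintro ⟨⟨σ, hσ⟩, h⟩
    refine ⟨⟨σ.swap, ?_⟩, ?_⟩
    · exact neg_injective ((key σ).symm.trans hσ)
    · rintro _ ⟨σ', rfl⟩
      exact neg_le_neg_iff.1 ((h ⟨σ'.swap, rfl⟩).trans (key _).le)

lemma isSecurityLevel₂_iff (M : K → L → A → B → ℝ) (p : K → ℝ) (q : L → ℝ) (v : ℝ) :
    IsSecurityLevel₂ M T p q v ↔ IsSecurityLevel₁ (exchange M) T q p (-v) := by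
  simp only [IsSecurityLevel₂, IsSecurityLevel₁, isGreatest_payoff_iff]
  constructor
  · rintro ⟨⟨τ, hτ⟩, h⟩
    refine ⟨⟨τ.swap, hτ⟩, ?_⟩
    rintro c ⟨τ', hτ'⟩
    exact le_neg_of_le_neg (h ⟨τ'.swap, by rwa [neg_neg]⟩)
  · rintro ⟨⟨τ, hτ⟩, h⟩
    refine ⟨⟨τ.swap, hτ⟩, ?_⟩
    rintro c ⟨τ', hτ'⟩
    exact neg_le_neg_iff.1 (h ⟨τ'.swap, hτ'⟩)

lemma isSecurityStrategy₂_iff_exchange (M : K → L → A → B → ℝ) (p : K → ℝ) (q : L → ℝ)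
    (τ : Strategy L A B B T) :
    IsSecurityStrategy₂ M p q τ ↔ IsSecurityStrategy₁ (exchange M) q p τ.swap := by
  simp only [IsSecurityStrategy₂, IsSecurityStrategy₁, isGreatest_payoff_iff, isSecurityLevel₂_iff]
  exact ⟨fun ⟨v, h⟩ => ⟨-v, h⟩, fun ⟨v, h⟩ => ⟨-v, by rwa [neg_neg]⟩⟩

end Exchange

/-! ### Existence of the value -/

section Minimax

variable {K L A B : Type*} [Fintype A] {T : ℕ}

omit [Fintype A] in
lemma prevPlan₁_combo (p : K → ℝ) (x x' : Plan K A B A T) {r s : ℝ} (hrs : r + s = 1)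
    (t : Fin T) (k : K) (hA : Fin t → A) (hB : Fin t → B) :
    prevPlan₁ p (r • x + s • x') t k hA hB =
      r * prevPlan₁ p x t k hA hB + s * prevPlan₁ p x' t k hA hB := by
  obtain ⟨_ | t, ht⟩ := t
  · simp only [prevPlan₁, prevEntry, ← add_mul, hrs, one_mul]
  · rfl

lemma convex_isRealizationPlan₁ (p : K → ℝ) :
    Convex ℝ {x : Plan K A B A T | IsRealizationPlan₁ p x} := by
  intro x hx x' hx' r s hr hs hrs
  refine ⟨fun t k hA hB => ?_, fun t k hA hB a => ?_⟩
  · rw [prevPlan₁_combo p x x' hrs, ← hx.1, ← hx'.1, Finset.mul_sum, Finset.mul_sum,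
      ← Finset.sum_add_distrib]
    rfl
  · exact add_nonneg (mul_nonneg hr (hx.2 ..)) (mul_nonneg hs (hx'.2 ..))

lemma continuous_strategy_apply (t : Fin T) (k : K) (hA : Fin t → A) (hB : Fin t → B) (a : A) :
    Continuous fun σ : Strategy K A B A T => (σ t k hA hB).1 a :=
  (continuous_apply a).comp <| continuous_subtype_val.comp <|
    (continuous_apply hB).comp <| (continuous_apply hA).comp <|
      (continuous_apply k).comp (continuous_apply t)

lemma continuous_reach (p : K → ℝ) (n : ℕ) (k : K) (hA : Fin n → A) (hB : Fin n → B) :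
    Continuous fun σ : Strategy K A B A T => reach p σ n k hA hB := by
  induction n with
  | zero => exact continuous_const
  | succ n ih =>
    refine (ih _ _).mul ?_
    unfold stageProb
    split_ifs
    · exact continuous_strategy_apply ..
    · exact continuous_const

lemma continuous_planOf (p : K → ℝ) :
    Continuous (planOf p : Strategy K A B A T → Plan K A B A T) := by
  refine continuous_pi fun t => continuous_pi fun k => continuous_pi fun hA =>
    continuous_pi fun hB => continuous_pi fun a => (continuous_reach p t k hA hB).mul
      (continuous_strategy_apply t k hA hB a)

lemma range_planOf [Nonempty A] {p : K → ℝ} (hp : ∀ k, 0 ≤ p k) :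
    Set.range (planOf p : Strategy K A B A T → Plan K A B A T) = {x | IsRealizationPlan₁ p x} := by
  ext x
  refine ⟨?_, fun hx => ?_⟩
  · rintro ⟨σ, rfl⟩
    exact isRealizationPlan₁_planOf hp σ
  · obtain ⟨σ, hσ⟩ := IsRealizationPlan₁.exists_isRatioStrategy₁ hx
    exact ⟨σ, (hσ.eq_planOf hx).symm⟩

/-- The entry of a plan at the last stage, along a complete play. -/
def finalEntry {Θ A B : Type*} {n : ℕ} (x : Plan Θ A B A (n + 1)) (k : Θ)
    (a : Fin (n + 1) → A) (b : Fin (n + 1) → B) : ℝ :=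
  x (Fin.last n) k (Fin.init (α := fun _ => A) a) (Fin.init (α := fun _ => B) b) (a (Fin.last n))

lemma finalEntry_planOf {n : ℕ} (p : K → ℝ) (σ : Strategy K A B A (n + 1)) (k : K)
    (a : Fin (n + 1) → A) (b : Fin (n + 1) → B) :
    finalEntry (planOf p σ) k a b = reach p σ (n + 1) k a b := by
  unfold finalEntry planOf
  rw [← stageProb_fin]
  rfl

variable [Fintype K] [Fintype L] [Fintype B]

/-- The payoff as a bilinear function of the realization plans of the two players. -/
def planPayoff {n : ℕ} (M : K → L → A → B → ℝ) (y : Plan L B A B (n + 1))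
    (x : Plan K A B A (n + 1)) : ℝ :=
  ∑ k, ∑ l, ∑ a : Fin (n + 1) → A, ∑ b : Fin (n + 1) → B,
    finalEntry x k a b * finalEntry y l b a * ∑ t, M k l (a t) (b t)

lemma planPayoff_planOf {n : ℕ} (M : K → L → A → B → ℝ) (p : K → ℝ) (q : L → ℝ)
    (σ : Strategy K A B A (n + 1)) (τ : Strategy L A B B (n + 1)) :
    planPayoff M (planOf q τ.swap) (planOf p σ) = payoff M p q σ τ := by
  simp only [planPayoff, payoff, finalEntry_planOf, playProb_eq]

lemma planPayoff_combo_right {n : ℕ} (M : K → L → A → B → ℝ) (y : Plan L B A B (n + 1))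
    (x x' : Plan K A B A (n + 1)) (r s : ℝ) :
    planPayoff M y (r • x + s • x') = r * planPayoff M y x + s * planPayoff M y x' := by
  have h : ∀ k a b, finalEntry (r • x + s • x') k a b =
    r * finalEntry x k a b + s * finalEntry x' k a b := fun _ _ _ => rfl
  simp only [planPayoff, h, Finset.mul_sum, ← Finset.sum_add_distrib]
  refine Finset.sum_congr rfl fun k _ => Finset.sum_congr rfl fun l _ =>
    Finset.sum_congr rfl fun a _ => Finset.sum_congr rfl fun b _ =>
      Finset.sum_congr rfl fun t _ => ?_
  ring

lemma planPayoff_combo_left {n : ℕ} (M : K → L → A → B → ℝ) (y y' : Plan L B A B (n + 1))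
    (x : Plan K A B A (n + 1)) (r s : ℝ) :
    planPayoff M (r • y + s • y') x = r * planPayoff M y x + s * planPayoff M y' x := by
  have h : ∀ k a b, finalEntry (r • y + s • y') k a b =
    r * finalEntry y k a b + s * finalEntry y' k a b := fun _ _ _ => rfl
  simp only [planPayoff, h, Finset.mul_sum, ← Finset.sum_add_distrib]
  refine Finset.sum_congr rfl fun k _ => Finset.sum_congr rfl fun l _ =>
    Finset.sum_congr rfl fun a _ => Finset.sum_congr rfl fun b _ =>
      Finset.sum_congr rfl fun t _ => ?_
  ring

lemma continuous_planPayoff_right {n : ℕ} (M : K → L → A → B → ℝ) (y : Plan L B A B (n + 1)) :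
    Continuous (planPayoff M y) := by
  unfold planPayoff finalEntry
  fun_prop

lemma continuous_planPayoff_left {n : ℕ} (M : K → L → A → B → ℝ) (x : Plan K A B A (n + 1)) :
    Continuous fun y => planPayoff M y x := by
  unfold planPayoff finalEntry
  fun_prop

/-- Sion's theorem applied to the polytopes of realization plans. -/
lemma exists_saddlePoint [Nonempty A] [Nonempty B] (M : K → L → A → B → ℝ) (hT : 1 ≤ T)
    {p : K → ℝ} (hp : ∀ k, 0 ≤ p k) {q : L → ℝ} (hq : ∀ l, 0 ≤ q l) :
    ∃ (σ₀ : Strategy K A B A T) (τ₀ : Strategy L A B B T),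
      ∀ σ τ, payoff M p q σ τ₀ ≤ payoff M p q σ₀ τ := by
  classical
  obtain ⟨n, rfl⟩ := Nat.exists_eq_add_of_le' hT
  have : Nonempty (Strategy K A B A (n + 1)) :=
    ⟨fun _ _ _ _ => ⟨_, single_mem_stdSimplex ℝ (Classical.arbitrary A)⟩⟩
  have : Nonempty (Strategy L B A B (n + 1)) :=
    ⟨fun _ _ _ _ => ⟨_, single_mem_stdSimplex ℝ (Classical.arbitrary B)⟩⟩
  have cX : Convex ℝ (Set.range (planOf p : Strategy K A B A (n + 1) → _)) := by
    rw [range_planOf hp]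
    exact convex_isRealizationPlan₁ p
  have cY : Convex ℝ (Set.range (planOf q : Strategy L B A B (n + 1) → _)) := by
    rw [range_planOf hq]
    exact convex_isRealizationPlan₁ q
  obtain ⟨_, ⟨τ₀, rfl⟩, _, ⟨σ₀, rfl⟩, h⟩ := Sion.exists_isSaddlePointOn (f := planPayoff M)
    (Set.range_nonempty _) cY (isCompact_range (continuous_planOf q))
    (fun x _ => (continuous_planPayoff_left M x).lowerSemicontinuous.lowerSemicontinuousOn _)
    (fun x _ => ConvexOn.quasiconvexOn ⟨cY, fun y _ y' _ r s _ _ _ =>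
      (planPayoff_combo_left M y y' x r s).le⟩)
    cX (Set.range_nonempty _) (isCompact_range (continuous_planOf p))
    (fun y _ => (continuous_planPayoff_right M y).upperSemicontinuous.upperSemicontinuousOn _)
    (fun y _ => ConcaveOn.quasiconcaveOn ⟨cX, fun x _ x' _ r s _ _ _ =>
      (planPayoff_combo_right M y x x' r s).ge⟩)
  refine ⟨σ₀, τ₀.swap, fun σ τ => ?_⟩
  rw [← planPayoff_planOf, ← planPayoff_planOf]
  exact h _ ⟨τ.swap, rfl⟩ _ ⟨σ, rfl⟩

/-- The game has a value. -/
lemma exists_isGameValue [Nonempty A] [Nonempty B] (M : K → L → A → B → ℝ) (hT : 1 ≤ T)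
    {p : K → ℝ} (hp : ∀ k, 0 ≤ p k) {q : L → ℝ} (hq : ∀ l, 0 ≤ q l) :
    ∃ V, IsGameValue M T p q V := by
  obtain ⟨σ₀, τ₀, h⟩ := exists_saddlePoint M hT hp hq
  refine ⟨payoff M p q σ₀ τ₀, ⟨⟨σ₀, ⟨τ₀, rfl⟩, ?_⟩, ?_⟩, ⟨τ₀, ⟨σ₀, rfl⟩, ?_⟩, ?_⟩
  · rintro _ ⟨τ, rfl⟩
    exact h σ₀ τ
  · rintro c ⟨σ, hσ⟩
    exact (hσ.2 ⟨τ₀, rfl⟩).trans (h σ τ₀)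
  · rintro _ ⟨σ, rfl⟩
    exact h σ τ₀
  · rintro c ⟨τ, hτ⟩
    exact (h σ₀ τ).trans (hτ.2 ⟨σ₀, rfl⟩)

end Minimax

end RepeatedBayesianGame

theorem mainTheorem1 {K L A B : Type*} [Fintype K] [Fintype L] [Fintype A] [Fintype B]
    [Nonempty A] [Nonempty B] (M : K → L → A → B → ℝ) (T : ℕ) (hT : 1 ≤ T)
    (p : K → ℝ) (hp : p ∈ stdSimplex ℝ K) (q : L → ℝ) (hq : q ∈ stdSimplex ℝ L) :
    ∃ V : ℝ, RepeatedBayesianGame.IsGameValue M T p q V ∧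
      -- the linear program of player 1
      IsGreatest {v : ℝ | ∃ (x : RepeatedBayesianGame.Plan K A B A T)
        (u : RepeatedBayesianGame.Continuation L A B T) (u₀ : L → ℝ),
        RepeatedBayesianGame.PrimalFeasible M p x u u₀ ∧ v = ∑ l : L, q l * u₀ l} V ∧
      (∀ (x : RepeatedBayesianGame.Plan K A B A T)
        (u : RepeatedBayesianGame.Continuation L A B T) (u₀ : L → ℝ),
        RepeatedBayesianGame.PrimalOptimal M p q x u u₀ →
          ∃ σ : RepeatedBayesianGame.Strategy K A B A T,
            RepeatedBayesianGame.IsRatioStrategy₁ p x σ) ∧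
      (∀ σ : RepeatedBayesianGame.Strategy K A B A T,
        RepeatedBayesianGame.IsSecurityStrategy₁ M p q σ ↔
          ∃ (x : RepeatedBayesianGame.Plan K A B A T)
            (u : RepeatedBayesianGame.Continuation L A B T) (u₀ : L → ℝ),
            RepeatedBayesianGame.PrimalOptimal M p q x u u₀ ∧
              RepeatedBayesianGame.IsRatioStrategy₁ p x σ) ∧
      -- the linear program of player 2
      IsLeast {v : ℝ | ∃ (y : RepeatedBayesianGame.Plan L A B B T)
        (w : RepeatedBayesianGame.Continuation K A B T) (w₀ : K → ℝ),
        RepeatedBayesianGame.DualFeasible M q y w w₀ ∧ v = ∑ k : K, p k * w₀ k} V ∧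
      (∀ (y : RepeatedBayesianGame.Plan L A B B T)
        (w : RepeatedBayesianGame.Continuation K A B T) (w₀ : K → ℝ),
        RepeatedBayesianGame.DualOptimal M p q y w w₀ →
          ∃ τ : RepeatedBayesianGame.Strategy L A B B T,
            RepeatedBayesianGame.IsRatioStrategy₂ q y τ) ∧
      (∀ τ : RepeatedBayesianGame.Strategy L A B B T,
        RepeatedBayesianGame.IsSecurityStrategy₂ M p q τ ↔
          ∃ (y : RepeatedBayesianGame.Plan L A B B T)
            (w : RepeatedBayesianGame.Continuation K A B T) (w₀ : K → ℝ),
            RepeatedBayesianGame.DualOptimal M p q y w w₀ ∧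
              RepeatedBayesianGame.IsRatioStrategy₂ q y τ) := by
  have hp0 := hp.1
  have hq0 := hq.1
  -- The program of player 2 is that of player 1 in the game with the roles exchanged, whose value
  -- is `-V`.
  obtain ⟨V, hV⟩ := RepeatedBayesianGame.exists_isGameValue M hT hp0 hq0
  have hV₂ := (RepeatedBayesianGame.isSecurityLevel₂_iff M p q V).1 hV.2
  have hneg : ∀ z : K → ℝ, ∑ k, p k * (-z) k = -∑ k, p k * z k := by simp
  refine ⟨V, hV, RepeatedBayesianGame.isGreatest_primal hT hp0 hq0 hV.1,
    fun x u u₀ h => h.1.plan.exists_isRatioStrategy₁,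
    RepeatedBayesianGame.isSecurityStrategy₁_iff hT hp0 hq0 hV.1, ⟨?_, ?_⟩, ?_, fun τ => ?_⟩
  · obtain ⟨y, w, w₀, hf, he⟩ := (RepeatedBayesianGame.isGreatest_primal hT hq0 hp0 hV₂).1
    exact ⟨_, _, _, RepeatedBayesianGame.dualFeasible_of_exchange hf, by rw [hneg, ← he, neg_neg]⟩
  · rintro _ ⟨y, w, w₀, hf, rfl⟩
    have := ((RepeatedBayesianGame.dualFeasible_iff M q y w w₀).1 hf).sum_le hT hq0 hp0 hV₂
    rw [hneg] at this
    exact neg_le_neg_iff.1 this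
  · intro y w w₀ h
    obtain ⟨τ, hτ⟩ := ((RepeatedBayesianGame.isRealizationPlan₂_iff q y).1
      h.1.plan).exists_isRatioStrategy₁
    exact ⟨τ.swap, (RepeatedBayesianGame.isRatioStrategy₂_iff q y τ.swap).2 hτ⟩
  · rw [RepeatedBayesianGame.isSecurityStrategy₂_iff_exchange,
      RepeatedBayesianGame.isSecurityStrategy₁_iff hT hq0 hp0 hV₂]
    constructor
    · rintro ⟨y, w, w₀, ho, hr⟩
      refine ⟨y.swap, w.exchange, -w₀, (RepeatedBayesianGame.dualOptimal_iff ..).2 ?_,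
        (RepeatedBayesianGame.isRatioStrategy₂_iff ..).2 hr⟩
      rw [w.exchange_exchange, neg_neg]
      exact ho
    · rintro ⟨y, w, w₀, ho, hr⟩
      exact ⟨_, _, _, (RepeatedBayesianGame.dualOptimal_iff ..).1 ho,
        (RepeatedBayesianGame.isRatioStrategy₂_iff ..).1 hr⟩
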